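/- Let $\mathcal T$ be the smallest class of sets that contains every one-element set and is closed under disjoint union $\Sigma+\Gamma$, product $\Sigma\times\Gamma$ and finite lists $\Sigma^*$. The *first-order list functions* are the smallest class of functions between sets of $\mathcal T$ that contains, for all $\Sigma,\Gamma,\Delta\in\mathcal T$, - all constant functions; - the two projections $\Sigma\times\Gamma\to\Sigma$, $\Sigma\times\Gamma\to\Gamma$, the two coprojections $\Sigma\to\Sigma+\Gamma$, $\Gamma\to\Sigma+\Gamma$, and the natural map $(\Sigma+\Gamma)\times\Delta\to(\Sigma\times\Delta)+(\Gamma\times\Delta)$; - list reversal $\Sigma^*\to\Sigma^*$, flattening $\Sigma^{**}\to\Sigma^*$, and $\Sigma\times\Sigma^*\to\Sigma^*$, $(x_0,[x_1,\dots,x_n])\mapsto[x_0,x_1,\dots,x_n]$; - the map $\Sigma^*\to(\Sigma\times\Sigma^*)+\{\bot\}$ sending a nonempty list to the pair of its head and tail, and the empty list to $\bot$; - the map $(\Sigma+\Gamma)^*\to(\Sigma^*+\Gamma^*)^*$ cutting a list into its maximal nonempty blocks of elements of $\Sigma$ and of elements of $\Gamma$; and is closed under composition, disjoint union ($f:\Sigma\to\Delta$,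 $g:\Gamma\to\Delta$ give $f+g:\Sigma+\Gamma\to\Delta$), map ($f:\Sigma\to\Gamma$ gives $f^*:\Sigma^*\to\Gamma^*$) and pairing ($f:\Sigma\to\Gamma$, $g:\Sigma\to\Delta$ give $(f,g):\Sigma\to\Gamma\times\Delta$). A monoid $M$ is *aperiodic* if there is $n\ge 1$ with $m^n=m^{n+1}$ for all $m\in M$. An *aperiodic rational function* is given by nonempty finite alphabets $\Sigma,\Gamma$, a homomorphism $h:\Sigma^*\to M$ into a finite aperiodic monoid $M$, and a function $\mathrm{out}:M\times\Sigma\times M\to\Gamma^*$; it is the function $$\Sigma^*\to\Gamma^*,\qquad a_1\cdots a_n\mapsto w_1\cdots w_n,\qquad w_i=\mathrm{out}\bigl(h(a_1\cdots a_{i-1}),\,a_i,\,h(a_{i+1}\cdots a_n)\bigr).$$ **Theorem.** Every aperiodic rational function is a first-order list function. Here the nonempty finite alphabets $\Sigma$ and $\Gamma$ are regarded as sets of $\mathcal T$ by identifying each of them, through a bijection, with a set of $\mathcal T$; such identifications exist, and the statement holds for every choice of them. -/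

import Mathlib

universe u v w

/-- Codes for the types generated by the grammar
`T := every one-element set | T + T | T × T | T*`. -/
inductive ListType : Type (u + 1) where
  | single (A : Type u) [Unique A] : ListType
  | sum (σ τ : ListType) : ListType
  | prod (σ τ : ListType) : ListType
  | list (σ : ListType) : ListType

namespace ListType

/-- The set of elements of a type of the grammar. -/
@[reducible] def El : ListType.{u} → Type u
  | single A => A
  | sum σ τ => σ.El ⊕ τ.El
  | prod σ τ => σ.El × τ.El
  | list σ => List σ.El

/-- The special one-element type `⊥`. -/
@[reducible] def bot : ListType.{u} := single PUnit.{u + 1}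

end ListType

namespace ListFun

variable {A B C : Type u}

/-- The natural map `(A + B) × C → (A × C) + (B × C)`. -/
def distribute : (A ⊕ B) × C → (A × C) ⊕ (B × C)
  | (Sum.inl a, c) => Sum.inl (a, c)
  | (Sum.inr b, c) => Sum.inr (b, c)

/-- `(x₀, [x₁, …, xₙ]) ↦ [x₀, x₁, …, xₙ]`. -/
def append : A × List A → List A
  | (a, l) => a :: l

/-- Splits a nonempty list into head and tail; the empty list is sent to `⊥`. -/
def coappend : List A → (A × List A) ⊕ PUnit.{u + 1}
  | [] => Sum.inr PUnit.unit
  | a :: l => Sum.inl (a, l)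

/-- Puts one more letter in front of a list of blocks: it joins the first block if that block is
of the same kind, and otherwise becomes a new block of length one. -/
def consBlock : A ⊕ B → List (List A ⊕ List B) → List (List A ⊕ List B)
  | Sum.inl a, Sum.inl l :: r => Sum.inl (a :: l) :: r
  | Sum.inl a, r => Sum.inl [a] :: r
  | Sum.inr b, Sum.inr l :: r => Sum.inr (b :: l) :: r
  | Sum.inr b, r => Sum.inr [b] :: r

/-- Cuts a list over `A + B` into its maximal nonempty blocks of letters from `A` and of letters
from `B`. -/
def block : List (A ⊕ B) → List (List A ⊕ List B)
  | [] => []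
  | x :: l => consBlock x (block l)

end ListFun

open ListType in
/-- First-order list functions: the smallest class of functions between types of the grammar that
contains the basic functions and is closed under the four combinators. -/
inductive FOListFunction : ∀ σ τ : ListType.{u}, (σ.El → τ.El) → Prop where
  -- basic functions
  | const (σ τ : ListType.{u}) (c : τ.El) : FOListFunction σ τ (fun _ => c)
  | projection₁ (σ τ : ListType.{u}) : FOListFunction (prod σ τ) σ Prod.fst
  | projection₂ (σ τ : ListType.{u}) : FOListFunction (prod σ τ) τ Prod.snd
  | coprojection₁ (σ τ : ListType.{u}) : FOListFunction σ (sum σ τ) Sum.inl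
  | coprojection₂ (σ τ : ListType.{u}) : FOListFunction τ (sum σ τ) Sum.inr
  | distribute (σ τ ρ : ListType.{u}) :
      FOListFunction (prod (sum σ τ) ρ) (sum (prod σ ρ) (prod τ ρ)) ListFun.distribute
  | reverse (σ : ListType.{u}) : FOListFunction (list σ) (list σ) List.reverse
  | flat (σ : ListType.{u}) : FOListFunction (list (list σ)) (list σ) List.flatten
  | append (σ : ListType.{u}) : FOListFunction (prod σ (list σ)) (list σ) ListFun.append
  | coappend (σ : ListType.{u}) :
      FOListFunction (list σ) (sum (prod σ (list σ)) bot) ListFun.coappend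
  | block (σ τ : ListType.{u}) :
      FOListFunction (list (sum σ τ)) (list (sum (list σ) (list τ))) ListFun.block
  -- combinators
  | disjointUnion (σ τ ρ : ListType.{u}) (f : σ.El → ρ.El) (g : τ.El → ρ.El) :
      FOListFunction σ ρ f → FOListFunction τ ρ g →
      FOListFunction (sum σ τ) ρ (Sum.elim f g)
  | comp (σ τ ρ : ListType.{u}) (g : τ.El → ρ.El) (f : σ.El → τ.El) :
      FOListFunction τ ρ g → FOListFunction σ τ f → FOListFunction σ ρ (g ∘ f)
  | map (σ τ : ListType.{u}) (f : σ.El → τ.El) :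
      FOListFunction σ τ f → FOListFunction (list σ) (list τ) (List.map f)
  | pairing (σ τ ρ : ListType.{u}) (f : σ.El → τ.El) (g : σ.El → ρ.El) :
      FOListFunction σ τ f → FOListFunction σ ρ g →
      FOListFunction σ (prod τ ρ) (fun x => (f x, g x))

/-- A monoid is aperiodic if `m ^ n = m ^ (n + 1)` for all `m`, for some positive `n`. -/
def AperiodicMonoid (M : Type u) [Monoid M] : Prop :=
  ∃ n : ℕ, 0 < n ∧ ∀ m : M, m ^ n = m ^ (n + 1)

/-- The syntax of a rational function with input alphabet `A`, output alphabet `B` and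
monoid `M`. -/
structure RationalFunction (A : Type u) (B : Type v) (M : Type w) [Monoid M] where
  /-- the homomorphism from words over `A` to the monoid -/
  h : FreeMonoid A →* M
  /-- the output function -/
  out : M × A × M → List B

/-- The semantics: `a₁ ⋯ aₙ` is sent to `w₁ ⋯ wₙ`, where `wᵢ` is the output on the value of the
prefix before position `i`, the letter `aᵢ`, and the value of the suffix after position `i`. -/
def RationalFunction.eval {A : Type u} {B : Type v} {M : Type w} [Monoid M]
    (R : RationalFunction A B M) (x : List A) : List B :=
  (List.ofFn fun i : Fin x.length =>
    R.out (R.h (FreeMonoid.ofList (x.take i)), x.get i,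
      R.h (FreeMonoid.ofList (x.drop (i + 1))))).flatten

/-! The output at a position depends only on its letter and on the values of the prefix and suffix
around it, all ranging over finite sets. So it suffices to label positions with prefix values and,
by reversal over the opposite monoid, with suffix values.

Prefix labelling is proved by induction on the size of `M`, then on the number of values other than
`1` taken by single letters. Pick such a value `c`, cut the word after each letter of value `c`, and
replace that value by `1`; the inner induction labels the inside of the blocks. If `x₁, x₂, …` are
the block values after this erasure, the prefix before a later block has value `x₁ c x₂ c ⋯ xⱼ c`.
Behind `x₁` this is the product of the elements `c xᵢ c` with `i ≥ 2` in the local divisor `cM ∩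
Mc`, whose identity is `c`. Aperiodicity gives `1 ∉ cM`, so the local divisor is smaller than `M`,
and the outer induction handles the word of blocks. The step is carried by
`prefixes_eq_blockPrefixes`, `blockPrefixes_eq_flatMap`, `LocalDivisor.card_lt` and
`prefixes_of_localDivisor`. -/

namespace ListType

/-! ### Finite alphabets as types of the grammar. -/

instance nonempty_El : ∀ σ : ListType.{u}, Nonempty σ.El
  | single A => ⟨(default : A)⟩
  | sum σ _ => (nonempty_El σ).elim fun x => ⟨Sum.inl x⟩
  | prod σ τ => (nonempty_El σ).elim fun x => (nonempty_El τ).elim fun y => ⟨(x, y)⟩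
  | list _ => ⟨[]⟩

/-- Every nonempty finite type is, up to a bijection, a type of the grammar. -/
theorem exists_equiv (A : Type v) [Finite A] [Nonempty A] :
    ∃ σ : ListType.{u}, Nonempty (A ≃ σ.El) := by
  have key : ∀ n : ℕ, ∃ σ : ListType.{u}, Nonempty (Fin (n + 1) ≃ σ.El) := by
    intro n
    induction n with
    | zero => exact ⟨bot, ⟨Equiv.ofUnique (Fin 1) PUnit.{u + 1}⟩⟩
    | succ n ih =>
      obtain ⟨σ, ⟨e⟩⟩ := ih
      exact ⟨sum σ bot, ⟨finSumFinEquiv.symm.trans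
        (Equiv.sumCongr e (Equiv.ofUnique (Fin 1) PUnit.{u + 1}))⟩⟩
  obtain ⟨n, ⟨e⟩⟩ := Finite.exists_equiv_fin A
  cases n with
  | zero => exact (IsEmpty.false (e (Classical.arbitrary A))).elim
  | succ n =>
    obtain ⟨σ, ⟨e'⟩⟩ := key n
    exact ⟨σ, ⟨e.trans e'⟩⟩

end ListType

/-! ### Closure properties: finite case distinctions and list operations. -/

namespace FOListFunction

open ListType

variable {σ τ ρ : ListType.{u}}

theorem congr {f g : σ.El → τ.El} (hf : FOListFunction σ τ f) (h : ∀ x, f x = g x) :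
    FOListFunction σ τ g :=
  funext h ▸ hf

/-- The identity is not a basic function; on lists it arises by reversing twice. -/
theorem id : ∀ σ : ListType.{u}, FOListFunction σ σ (fun x => x)
  | single A => (const (single A) (single A) default).congr fun _ => Subsingleton.elim _ _
  | sum σ τ => (disjointUnion σ τ (sum σ τ) _ _ (coprojection₁ σ τ) (coprojection₂ σ τ)).congr
      fun x => by cases x <;> rfl
  | prod σ τ => pairing (prod σ τ) σ τ _ _ (projection₁ σ τ) (projection₂ σ τ)
  | list σ => (comp _ _ _ _ _ (reverse σ) (reverse σ)).congr fun l => List.reverse_reverse l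

/-- A function of two arguments, the first of which ranges over a finite type, may be checked for
each value of this argument separately. -/
theorem of_finite_left : ∀ (σ : ListType.{u}) {ρ τ : ListType.{u}} [Finite σ.El]
    (F : σ.El × ρ.El → τ.El), (∀ x, FOListFunction ρ τ fun y => F (x, y)) →
    FOListFunction (prod σ ρ) τ F
  | single A, ρ, τ, _, F, h =>
    (comp (prod (single A) ρ) ρ τ _ _ (h default) (projection₂ (single A) ρ)).congr
      fun ⟨x, y⟩ => by rw [Unique.eq_default x]; rfl
  | sum σ₁ σ₂, ρ, τ, hfin, F, h => by
    have : Finite (σ₁.El ⊕ σ₂.El) := hfin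
    have : Finite σ₁.El := Finite.of_injective _ (Sum.inl_injective (β := σ₂.El))
    have : Finite σ₂.El := Finite.of_injective _ (Sum.inr_injective (α := σ₁.El))
    refine (comp _ _ _ _ _ (disjointUnion _ _ _ _ _
      (of_finite_left σ₁ (ρ := ρ) (fun p => F (Sum.inl p.1, p.2)) fun x => h (Sum.inl x))
      (of_finite_left σ₂ (ρ := ρ) (fun p => F (Sum.inr p.1, p.2)) fun x => h (Sum.inr x)))
      (distribute σ₁ σ₂ ρ)).congr ?_
    rintro ⟨x | x, y⟩ <;> rfl
  | prod σ₁ σ₂, ρ, τ, hfin, F, h => by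
    have : Finite (σ₁.El × σ₂.El) := hfin
    have : Finite σ₁.El := Finite.of_surjective _ (Prod.fst_surjective (β := σ₂.El))
    have : Finite σ₂.El := Finite.of_surjective _ (Prod.snd_surjective (α := σ₁.El))
    have key : FOListFunction (prod σ₁ (prod σ₂ ρ)) τ fun p => F ((p.1, p.2.1), p.2.2) :=
      of_finite_left σ₁ (ρ := prod σ₂ ρ) _ fun x₁ => of_finite_left σ₂ (ρ := ρ) _ fun x₂ =>
        h (x₁, x₂)
    have fst := projection₁ (prod σ₁ σ₂) ρ
    exact (comp _ _ _ _ _ key (pairing _ _ _ _ _ (comp _ _ _ _ _ (projection₁ σ₁ σ₂) fst)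
      (pairing _ _ _ _ _ (comp _ _ _ _ _ (projection₂ σ₁ σ₂) fst)
        (projection₂ (prod σ₁ σ₂) ρ)))).congr fun _ => rfl
  -- Lists over a nonempty set form an infinite set, so finiteness excludes this case.
  | list σ, _, _, hfin, _, _ => by
    have : Finite (List σ.El) := hfin
    exact (not_finite (List σ.El)).elim

theorem of_finite [Finite σ.El] (f : σ.El → τ.El) : FOListFunction σ τ f :=
  (comp _ _ _ _ _ (of_finite_left σ (ρ := bot) (fun p => f p.1) fun x => const bot τ (f x))
    (pairing _ _ _ _ _ (id σ) (const σ bot PUnit.unit))).congr fun _ => rfl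

/-- Case distinction on the value of a function into a finite type. -/
theorem cases_on [Finite σ.El] {k : ρ.El → σ.El} (hk : FOListFunction ρ σ k)
    (F : σ.El → ρ.El → τ.El) (h : ∀ x, FOListFunction ρ τ (F x)) :
    FOListFunction ρ τ fun y => F (k y) y :=
  comp _ _ _ _ _ (of_finite_left σ (ρ := ρ) (fun p => F p.1 p.2) h)
    (pairing _ _ _ _ _ hk (id ρ))

/-- Case distinction between the empty list and nonempty lists. -/
theorem list_cases {F : List σ.El → τ.El}
    (h : FOListFunction (prod σ (list σ)) τ fun p => F (p.1 :: p.2)) :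
    FOListFunction (list σ) τ F :=
  (comp _ _ _ _ _ (disjointUnion _ _ _ _ _ h (const bot τ (F []))) (coappend σ)).congr
    fun l => by cases l <;> rfl

theorem cons {f : ρ.El → σ.El} {g : ρ.El → List σ.El} (hf : FOListFunction ρ σ f)
    (hg : FOListFunction ρ (list σ) g) : FOListFunction ρ (list σ) fun x => f x :: g x :=
  comp _ _ _ _ _ (append σ) (pairing _ _ _ _ _ hf hg)

theorem concat {f g : ρ.El → List σ.El} (hf : FOListFunction ρ (list σ) f)
    (hg : FOListFunction ρ (list σ) g) : FOListFunction ρ (list σ) fun x => f x ++ g x :=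
  (comp _ _ _ _ _ (flat σ) (cons hf (cons hg (const ρ (list (list σ)) [])))).congr
    fun x => by simp

theorem flatMap {f : σ.El → List τ.El} (hf : FOListFunction σ (list τ) f) :
    FOListFunction (list σ) (list τ) fun l => l.flatMap f :=
  (comp _ _ _ _ _ (flat τ) (map _ _ _ hf)).congr fun _ => rfl

end FOListFunction

/-! ### Cutting words into blocks and labelling positions by prefix values. -/

namespace ListFun

variable {A : Type u}

open Classical in
/-- Cuts a list after each letter that satisfies `p`. -/
noncomputable def splitAfter (p : A → Prop) : List A → List (List A)
  | [] => []
  | a :: l => if p a then [a] :: splitAfter p l else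
    match splitAfter p l with
    | [] => [[a]]
    | b :: r => (a :: b) :: r

open Classical in
/-- Inserts a separator after each letter that satisfies `p`. -/
noncomputable def separate (p : A → Prop) (a : A) : List (PUnit.{u + 1} ⊕ A) :=
  if p a then [Sum.inr a, Sum.inl PUnit.unit] else [Sum.inr a]

/-- The blocks of the second kind. -/
def rightBlocks {B C : Type u} (l : List (B ⊕ C)) : List C :=
  l.flatMap (Sum.elim (fun _ => []) fun c => [c])

theorem rightBlocks_consBlock_inl {B C : Type u} (b : B) (l : List (List B ⊕ List C)) :
    rightBlocks (consBlock (Sum.inl b) l) = rightBlocks l := by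
  rcases l with _ | ⟨x | x, l⟩ <;> rfl

theorem consBlock_inl_eq {B C : Type u} (b : B) (l : List (List B ⊕ List C)) :
    ∃ x r, consBlock (Sum.inl b) l = Sum.inl x :: r := by
  rcases l with _ | ⟨x | x, l⟩ <;> exact ⟨_, _, rfl⟩

/-- Every separator follows its own letter, so the maximal blocks of letters are the pieces of the
cut. The first conjunct is needed for the induction: no separator comes first, so a letter outside
`p` joins the first piece. -/
theorem block_separate (p : A → Prop) (l : List A) :
    (block (l.flatMap (separate p)) = [] ∨
      ∃ b r, block (l.flatMap (separate p)) = Sum.inr b :: r) ∧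
    rightBlocks (block (l.flatMap (separate p))) = splitAfter p l := by
  induction l with
  | nil => exact ⟨Or.inl rfl, rfl⟩
  | cons a l ih =>
    obtain ⟨ih₁, ih₂⟩ := ih
    rw [List.flatMap_cons, splitAfter]
    by_cases h : p a
    · obtain ⟨x, r, hx⟩ := consBlock_inl_eq PUnit.unit (block (l.flatMap (separate p)))
      have e := rightBlocks_consBlock_inl PUnit.unit (block (l.flatMap (separate p)))
      rw [hx, ih₂] at e
      simp only [separate, h, if_true, List.cons_append, List.nil_append, block]
      rw [hx]
      exact ⟨Or.inr ⟨_, _, rfl⟩, congrArg ([a] :: ·) e⟩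
    · rw [separate, if_neg h, if_neg h, List.cons_append, List.nil_append, block, ← ih₂]
      rcases ih₁ with h₀ | ⟨b, r, h₀⟩ <;> rw [h₀]
      · exact ⟨Or.inr ⟨_, _, rfl⟩, rfl⟩
      · exact ⟨Or.inr ⟨_, _, rfl⟩, rfl⟩

variable {M : Type v} [Monoid M]

/-- Pairs each letter with the value of the prefix before it, multiplied by `p` from the left. -/
def prefixes {A : Type w} (h : A → M) : M → List A → List (M × A)
  | _, [] => []
  | p, a :: l => (p, a) :: prefixes h (p * h a) l

section prefixes

variable {A : Type w}

theorem prefixes_append_singleton (h : A → M) (p : M) (l : List A) (a : A) :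
    prefixes h p (l ++ [a]) = prefixes h p l ++ [(p * (l.map h).prod, a)] := by
  induction l generalizing p with
  | nil => simp [prefixes]
  | cons b l ih => simp [prefixes, ih, mul_assoc]

theorem prefixes_mul (h : A → M) (p q : M) (l : List A) :
    prefixes h (p * q) l = (prefixes h q l).map fun x => (p * x.1, x.2) := by
  induction l generalizing q with
  | nil => rfl
  | cons b l ih => simp [prefixes, mul_assoc, ih]

/-- The value of a word, read off from its last letter and the prefix before it. -/
def lastValue (h : A → M) (l : List (M × A)) : M :=
  match l.reverse with
  | [] => 1
  | x :: _ => x.1 * h x.2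

theorem lastValue_prefixes (h : A → M) (l : List A) :
    lastValue h (prefixes h 1 l) = (l.map h).prod := by
  induction l using List.reverseRecOn with
  | nil => rfl
  | append_singleton l a _ => simp [prefixes_append_singleton, lastValue]

open Classical in
/-- Replaces the value `c` by the neutral element. -/
noncomputable def erase (c : M) (m : M) : M := if m = c then 1 else m

/-- Evaluation of a list of blocks, each but the last one of which is followed by `c`. -/
def blockPrefixes (h : A → M) (c : M) : M → List (List A) → List (M × A)
  | _, [] => []
  | p, b :: r => prefixes h p b ++ blockPrefixes h c (p * (b.map h).prod * c) r

end prefixes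

/-- Only the last letter of a block can have value `c`, and a label does not involve the letter at
its own position, so erasing `c` changes no label inside a block. The factor `c` is restored on
passing to the next block; behind the final block it is never used, so that block need not end in
`c`. -/
theorem prefixes_eq_blockPrefixes (h : A → M) (c p : M) (l : List A) :
    prefixes h p l =
      blockPrefixes (fun a => erase c (h a)) c p (splitAfter (fun a => h a = c) l) := by
  induction l generalizing p with
  | nil => rfl
  | cons a l ih =>
    rw [prefixes, ih, splitAfter]
    by_cases ha : h a = c
    · simp [ha, blockPrefixes, prefixes, erase]
    · rw [if_neg ha]
      rcases hs : splitAfter (fun a => h a = c) l with _ | ⟨b, r⟩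
      · simp [blockPrefixes, prefixes]
      · simp [blockPrefixes, prefixes, erase, ha, mul_assoc]

/-- In the application `N` is the local divisor and `k x` stands for `c x c`. By `hk`, multiplying
by `k x` appends `x * c`, so passing to the next block is one step of prefix labelling over `N`. -/
theorem blockPrefixes_eq_flatMap {N : Type w} [Monoid N] (h : A → M) (c m : M) (ι : N → M)
    (k : M → N) (hk : ∀ s x, ι (s * k x) = ι s * x * c) (s : N) (l : List (List A)) :
    blockPrefixes h c (m * ι s) l =
      (prefixes (fun v => k (lastValue h v)) s (l.map (prefixes h 1))).flatMap
        fun x => x.2.map fun y => (m * ι x.1 * y.1, y.2) := by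
  induction l generalizing s with
  | nil => rfl
  | cons b r ih =>
    rw [List.map_cons, prefixes, List.flatMap_cons, ← ih, hk, lastValue_prefixes,
      blockPrefixes, ← prefixes_mul, mul_one]
    simp only [mul_assoc]

end ListFun

/-! ### Aperiodic monoids and local divisors. -/

theorem AperiodicMonoid.of_mulEquiv {M : Type u} {N : Type v} [Monoid M] [Monoid N]
    (hM : AperiodicMonoid M) (e : M ≃* N) : AperiodicMonoid N := by
  obtain ⟨n, hn, h⟩ := hM
  refine ⟨n, hn, fun m => e.symm.injective ?_⟩
  rw [map_pow, map_pow, h]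

theorem AperiodicMonoid.op {M : Type u} [Monoid M] (hM : AperiodicMonoid M) :
    AperiodicMonoid Mᵐᵒᵖ := by
  obtain ⟨n, hn, h⟩ := hM
  exact ⟨n, hn, fun m => MulOpposite.unop_injective (h m.unop)⟩

theorem AperiodicMonoid.eq_one_of_mul_eq_one {M : Type u} [Monoid M] (hM : AperiodicMonoid M)
    {c m : M} (h : c * m = 1) : c = 1 := by
  obtain ⟨n, -, hn⟩ := hM
  have key : ∀ k : ℕ, c ^ k * m ^ k = 1 := by
    intro k
    induction k with
    | zero => simp
    | succ k ih => rw [pow_succ, pow_succ', mul_assoc, ← mul_assoc c, h, one_mul, ih]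
  -- Multiplying `c ^ n = c ^ (n + 1)` by `m ^ n` on the right leaves `1 = c`.
  have := congrArg (· * m ^ n) (hn c)
  simp only [pow_succ', mul_assoc, key] at this
  simpa using this.symm

/-- The carrier `cM ∩ Mc` of the local divisor of a monoid at `c`. -/
def LocalDivisor {M : Type u} [Monoid M] (c : M) : Type u :=
  {x : M // (∃ y, x = y * c) ∧ ∃ z, x = c * z}

namespace LocalDivisor

variable {M : Type u} [Monoid M] {c : M}

/-- The product `yc ∘ cz = ycz`. -/
noncomputable instance : Mul (LocalDivisor c) where
  mul x y := ⟨x.2.1.choose * y.1, by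
    obtain ⟨-, z, hz⟩ := x.2
    obtain ⟨⟨y', hy⟩, z', hz'⟩ := y.2
    refine ⟨⟨x.2.1.choose * y', by rw [mul_assoc, ← hy]⟩, z * z', ?_⟩
    rw [hz', ← mul_assoc, ← x.2.1.choose_spec, hz, mul_assoc]⟩

/-- The product does not depend on the chosen left factor: if `y = c * z`, then `x' * y = x' * c * z
= x * z`. -/
theorem val_mul_left (x y : LocalDivisor c) {x' : M} (h : x.1 = x' * c) :
    (x * y).1 = x' * y.1 := by
  obtain ⟨-, z, hz⟩ := y.2
  change x.2.1.choose * y.1 = _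
  rw [hz, ← mul_assoc, ← mul_assoc, ← h, ← x.2.1.choose_spec]

theorem val_mul_right (x y : LocalDivisor c) {y' : M} (h : y.1 = c * y') :
    (x * y).1 = x.1 * y' := by
  obtain ⟨⟨x', hx⟩, -⟩ := x.2
  rw [val_mul_left x y hx, h, hx, mul_assoc]

instance : One (LocalDivisor c) where
  one := ⟨c, ⟨1, (one_mul c).symm⟩, 1, (mul_one c).symm⟩

theorem val_one : (1 : LocalDivisor c).1 = c := rfl

noncomputable instance : Monoid (LocalDivisor c) where
  mul_assoc x y z := by
    obtain ⟨⟨x', hx⟩, -⟩ := x.2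
    obtain ⟨-, z', hz⟩ := z.2
    apply Subtype.ext
    rw [val_mul_right _ _ hz, val_mul_left _ _ hx, val_mul_left _ _ hx, val_mul_right _ _ hz,
      mul_assoc]
  one_mul x := Subtype.ext (by rw [val_mul_left _ _ (x' := 1) (by rw [one_mul, val_one]), one_mul])
  mul_one x := Subtype.ext (by rw [val_mul_right _ _ (y' := 1) (by rw [mul_one, val_one]), mul_one])

theorem val_pow (x : LocalDivisor c) {x' : M} (h : x.1 = x' * c) (n : ℕ) :
    (x ^ n).1 = x' ^ n * c := by
  induction n with
  | zero => rw [pow_zero, pow_zero, one_mul, val_one]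
  | succ n ih => rw [pow_succ', pow_succ', val_mul_left _ _ h, ih, mul_assoc]

theorem aperiodic (hM : AperiodicMonoid M) : AperiodicMonoid (LocalDivisor c) := by
  obtain ⟨n, hn, h⟩ := hM
  refine ⟨n, hn, fun x => Subtype.ext ?_⟩
  obtain ⟨⟨x', hx⟩, -⟩ := x.2
  rw [val_pow x hx, val_pow x hx, h]

instance [Finite M] : Finite (LocalDivisor c) := Subtype.finite

theorem card_lt [Finite M] (hM : AperiodicMonoid M) (hc : c ≠ 1) :
    Nat.card (LocalDivisor c) < Nat.card M := by
  refine Finite.card_subtype_lt (x := (1 : M)) ?_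
  rintro ⟨-, z, hz⟩
  exact hc (hM.eq_one_of_mul_eq_one hz.symm)

/-- The element `cmc` of the local divisor. -/
def conj (c m : M) : LocalDivisor c := ⟨c * m * c, ⟨c * m, rfl⟩, m * c, mul_assoc _ _ _⟩

theorem val_mul_conj (s : LocalDivisor c) (m : M) : (s * conj c m).1 = s.1 * m * c := by
  rw [val_mul_right s _ (mul_assoc c m c), mul_assoc]

end LocalDivisor

/-- The local divisor at `c`, carried over to a type of the grammar. -/
theorem AperiodicMonoid.exists_localDivisor {M : Type v} [Monoid M] [Finite M]
    (hM : AperiodicMonoid M) {c : M} (hc : c ≠ 1) :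
    ∃ (ν : ListType.{u}) (_ : Monoid ν.El) (ι : ν.El → M) (k : M → ν.El), Finite ν.El ∧
      AperiodicMonoid ν.El ∧ Nat.card ν.El < Nat.card M ∧ ι 1 = c ∧
      ∀ s x, ι (s * k x) = ι s * x * c := by
  obtain ⟨ν, ⟨e⟩⟩ := ListType.exists_equiv.{u} (LocalDivisor c)
  let := e.symm.monoid
  let f : ν.El ≃* LocalDivisor c := e.symm.mulEquiv
  refine ⟨ν, inferInstance, fun s => (f s : LocalDivisor c).1, fun m => f.symm (LocalDivisor.conj c m),
    Finite.of_equiv _ e, (LocalDivisor.aperiodic hM).of_mulEquiv f.symm, ?_, ?_, fun s x => ?_⟩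
  · rw [← Nat.card_congr e]
    exact LocalDivisor.card_lt hM hc
  · exact (congrArg Subtype.val (map_one f)).trans LocalDivisor.val_one
  · refine (congrArg Subtype.val (map_mul f _ _)).trans ?_
    rw [f.apply_symm_apply]
    exact LocalDivisor.val_mul_conj (f s) x

/-! ### Prefix labelling is a first-order list function. -/

namespace FOListFunction

open ListType ListFun

variable {σ μ : ListType.{u}}

theorem splitAfter [Finite μ.El] {h : σ.El → μ.El} (hh : FOListFunction σ μ h) (c : μ.El) :
    FOListFunction (list σ) (list (list σ)) (ListFun.splitAfter fun a => h a = c) := by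
  classical
  have inr := coprojection₂ bot σ
  have nil := const σ (list (sum bot σ)) []
  have sep : FOListFunction σ (list (sum bot σ)) (separate fun a => h a = c) := by
    refine cases_on (τ := list (sum bot σ)) hh (fun m a => if m = c then
      [Sum.inr a, Sum.inl PUnit.unit] else [Sum.inr a]) fun m => ?_
    by_cases hm : m = c
    · simpa only [hm, if_true] using
        cons inr (cons (const σ (sum bot σ) (Sum.inl PUnit.unit)) nil)
    · simpa only [hm, if_false] using cons inr nil
  have right : FOListFunction (list (sum (list bot) (list σ))) (list (list σ)) rightBlocks :=
    flatMap (disjointUnion _ _ _ _ _ (const (list bot) (list (list σ)) [])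
      (cons (id (list σ)) (const (list σ) (list (list σ)) [])))
  exact (comp _ _ _ _ _ right (comp _ _ _ _ _ (block bot σ) (flatMap sep))).congr
    fun l => (block_separate _ l).2

theorem lastValue [Monoid μ.El] [Finite μ.El] {h : σ.El → μ.El} (hh : FOListFunction σ μ h) :
    FOListFunction (list (prod μ σ)) μ (ListFun.lastValue h) := by
  have step : FOListFunction (prod μ σ) μ fun x => x.1 * h x.2 :=
    of_finite_left μ _ fun m => comp _ _ _ _ _ (of_finite fun n => m * n) hh
  exact (comp _ _ _ (fun l : List (μ.El × σ.El) => match l with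
    | [] => 1
    | x :: _ => x.1 * h x.2) _
    (list_cases (comp _ _ _ _ _ step (projection₁ _ _))) (reverse (prod μ σ))).congr fun l => by
      rw [Function.comp_apply, ListFun.lastValue]
      cases l.reverse <;> rfl

/-- One step of the induction: the prefixes for `h` are computed from those for `h` with the
value `c` erased and those in the local divisor at `c`. -/
theorem prefixes_of_localDivisor [Monoid μ.El] [Finite μ.El] {ν : ListType.{u}} [Monoid ν.El]
    [Finite ν.El] {c : μ.El} {ι : ν.El → μ.El} {k : μ.El → ν.El} (hι : ι 1 = c)
    (hk : ∀ s x, ι (s * k x) = ι s * x * c)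
    (hν : ∀ (ρ : ListType.{u}) (g : ρ.El → ν.El), FOListFunction ρ ν g →
      FOListFunction (list ρ) (list (prod ν ρ)) (prefixes g 1))
    {h : σ.El → μ.El} (hh : FOListFunction σ μ h)
    (ih : FOListFunction (list σ) (list (prod μ σ)) (prefixes (fun a => erase c (h a)) 1)) :
    FOListFunction (list σ) (list (prod μ σ)) (prefixes h 1) := by
  set h' : σ.El → μ.El := fun a => erase c (h a) with hh'
  have fo_h' : FOListFunction σ μ h' := comp _ _ _ _ _ (of_finite (erase c)) hh
  have scale : ∀ m : μ.El, FOListFunction (list (prod μ σ)) (list (prod μ σ))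
      fun v => v.map fun y => (m * y.1, y.2) := fun m =>
    map _ _ _ (pairing _ _ _ _ _ (comp _ _ _ _ _ (of_finite fun n => m * n) (projection₁ μ σ))
      (projection₂ μ σ))
  have rest : ∀ m : μ.El, FOListFunction (list (list (prod μ σ))) (list (prod μ σ)) fun l =>
      (prefixes (fun v => k (ListFun.lastValue h' v)) 1 l).flatMap
        fun x => x.2.map fun y => (m * ι x.1 * y.1, y.2) := fun m =>
    comp _ _ _ _ _ (flatMap (of_finite_left ν (ρ := list (prod μ σ)) _ fun s => scale (m * ι s)))
      (hν (list (prod μ σ)) _ (comp _ _ _ _ _ (of_finite k) (lastValue fo_h')))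
  -- The first block stays outside the local divisor: its value is a left factor, and the `c` behind
  -- it is `ι 1`, where the labelling of the remaining blocks starts.
  let F : List (List (μ.El × σ.El)) → List (μ.El × σ.El)
    | [] => []
    | v :: l => v ++ (prefixes (fun v => k (ListFun.lastValue h' v)) 1 l).flatMap
        fun x => x.2.map fun y => (ListFun.lastValue h' v * ι x.1 * y.1, y.2)
  have fo_F : FOListFunction (list (list (prod μ σ))) (list (prod μ σ)) F :=
    list_cases (concat (projection₁ _ _)
      (cases_on (ρ := prod (list (prod μ σ)) (list (list (prod μ σ)))) (τ := list (prod μ σ))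
        (comp _ _ _ _ _ (lastValue fo_h') (projection₁ _ _))
        (fun m p => (prefixes (fun v => k (ListFun.lastValue h' v)) 1 p.2).flatMap
          fun x => x.2.map fun y => (m * ι x.1 * y.1, y.2))
        fun m => comp _ _ _ _ _ (rest m) (projection₂ _ _)))
  refine (comp _ _ _ _ _ fo_F (comp _ _ _ _ _ (map _ _ _ ih) (splitAfter hh c))).congr
    fun l => ?_
  rw [prefixes_eq_blockPrefixes h c, ← hh', Function.comp_apply, Function.comp_apply]
  rcases ListFun.splitAfter (fun a => h a = c) l with _ | ⟨v, r⟩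
  · rfl
  · change _ ++ _ = blockPrefixes h' c 1 (v :: r)
    rw [blockPrefixes, one_mul, ← hι, blockPrefixes_eq_flatMap h' (ι 1) _ ι k (hι ▸ hk) 1 r,
      lastValue_prefixes]

/-- The alphabet varies in the outer induction and may be infinite: over the local divisor, the
letters are labelled blocks. Only the monoid has to be finite. -/
theorem prefixes [Monoid μ.El] [Finite μ.El] (hμ : AperiodicMonoid μ.El) {h : σ.El → μ.El}
    (hh : FOListFunction σ μ h) :
    FOListFunction (list σ) (list (prod μ σ)) (ListFun.prefixes h 1) := by
  induction hn : Nat.card μ.El using Nat.strong_induction_on generalizing μ σ with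
  | _ n ihn =>
  subst hn
  induction hj : (Set.range h \ {1}).ncard using Nat.strong_induction_on generalizing h with
  | _ j ihj =>
  subst hj
  by_cases triv : ∀ a, h a = 1
  · refine (map _ _ _ (pairing _ _ _ _ _ (const σ μ 1) (id σ))).congr fun l => ?_
    induction l with
    | nil => rfl
    | cons a l ih => rw [ListFun.prefixes, triv, mul_one, List.map_cons, ih]
  · push Not at triv
    obtain ⟨a, ha⟩ := triv
    obtain ⟨ν, _, ι, k, _, hν, hcard, hι, hk⟩ := hμ.exists_localDivisor.{u} ha
    refine prefixes_of_localDivisor hι hk (fun ρ g hg => ihn _ hcard hν hg rfl) hh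
      (ihj _ ?_ (comp _ _ _ _ _ (of_finite (erase (h a))) hh) rfl)
    -- Erasing removes the value `h a` and introduces none other than `1`.
    refine Set.ncard_lt_ncard ⟨?_, fun hsub => ?_⟩ (Set.toFinite _)
    · rintro _ ⟨⟨b, rfl⟩, hb⟩
      by_cases hba : h b = h a <;> simp_all [erase]
    · obtain ⟨⟨b, hb⟩, -⟩ := hsub ⟨⟨a, rfl⟩, ha⟩
      by_cases hba : h b = h a
      · simp only [erase, hba, if_true] at hb
        exact ha hb.symm
      · simp only [erase, hba, if_false] at hb

/-- The function that pairs each letter with the value of the prefix before it, for a monoid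
that is identified with a type of the grammar. -/
theorem prefixes_equiv {M : Type v} [Monoid M] [Finite M] (hM : AperiodicMonoid M)
    (e : M ≃ μ.El) {h : σ.El → M} (hh : FOListFunction σ μ fun a => e (h a)) :
    FOListFunction (list σ) (list (prod μ σ))
      fun l => (ListFun.prefixes h 1 l).map fun x => (e x.1, x.2) := by
  let := e.symm.monoid
  have : Finite μ.El := Finite.of_equiv _ e
  let f : M ≃* μ.El := e.symm.mulEquiv.symm
  have key : ∀ p l, ListFun.prefixes (fun a => e (h a)) (f p) l =
      (ListFun.prefixes h p l).map fun x => (e x.1, x.2) := by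
    intro p l
    induction l generalizing p with
    | nil => rfl
    | cons a l ih =>
      rw [ListFun.prefixes, ListFun.prefixes, List.map_cons, ← ih, map_mul]
      rfl
  exact (prefixes (hM.of_mulEquiv f) hh).congr fun l => by rw [← key, map_one]

end FOListFunction

/-! ### Suffix labelling and evaluation of rational functions. -/

namespace ListFun

variable {A : Type u} {M : Type v} [Monoid M]

/-- Pairs each letter with the value of the suffix after it. -/
def suffixes (h : A → M) : List A → List (M × A)
  | [] => []
  | a :: l => ((l.map h).prod, a) :: suffixes h l

/-- Products in the opposite monoid over the reversed word are products over the original word. -/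
theorem suffixes_eq_reverse (h : A → M) (l : List A) :
    suffixes h l = ((prefixes (fun a => MulOpposite.op (h a)) 1 l.reverse).map
      fun x => (x.1.unop, x.2)).reverse := by
  induction l with
  | nil => rfl
  | cons a l ih =>
    rw [suffixes, ih, List.reverse_cons, prefixes_append_singleton, List.map_append,
      List.reverse_append, one_mul]
    simp [MulOpposite.unop_list_prod, Function.comp_def]

theorem prefixes_map {B : Type w} (h : B → M) (g : A → B) (p : M) (l : List A) :
    prefixes h p (l.map g) = (prefixes (fun a => h (g a)) p l).map fun x => (x.1, g x.2) := by
  induction l generalizing p with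
  | nil => rfl
  | cons a l ih => simp [prefixes, ih]

theorem suffixes_map {B : Type w} (h : B → M) (g : A → B) (l : List A) :
    suffixes h (l.map g) = (suffixes (fun a => h (g a)) l).map fun x => (x.1, g x.2) := by
  induction l with
  | nil => rfl
  | cons a l ih => simp [suffixes, ih, Function.comp_def]

end ListFun

open ListType in
theorem FOListFunction.suffixes_equiv {σ μ : ListType.{u}} {M : Type v} [Monoid M] [Finite M]
    (hM : AperiodicMonoid M) (e : M ≃ μ.El) {h : σ.El → M}
    (hh : FOListFunction σ μ fun a => e (h a)) :
    FOListFunction (list σ) (list (prod μ σ))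
      fun l => (ListFun.suffixes h l).map fun x => (e x.1, x.2) := by
  have : Finite Mᵐᵒᵖ := Finite.of_equiv _ MulOpposite.opEquiv
  refine (comp _ _ _ _ _ (reverse _) (comp _ _ _ _ _ (prefixes_equiv hM.op
    (MulOpposite.opEquiv.symm.trans e) (h := fun a => MulOpposite.op (h a)) hh)
    (reverse _))).congr fun l => ?_
  rw [ListFun.suffixes_eq_reverse, List.map_reverse, List.map_map]
  rfl

/-- The suffix labelling runs on the prefix-labelled word, with letter values that ignore the
labels, so each position carries both values. -/
theorem RationalFunction.eval_eq_flatMap {A : Type u} {B : Type w} {M : Type v} [Monoid M]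
    (R : RationalFunction A B M) (l : List A) :
    R.eval l = (ListFun.suffixes (fun x => R.h (FreeMonoid.of x.2))
      (ListFun.prefixes (fun a => R.h (FreeMonoid.of a)) 1 l)).flatMap
        fun x => R.out (x.2.1, x.2.2, x.1) := by
  have value : ∀ (p : M) (l : List A), ((ListFun.prefixes (fun a => R.h (FreeMonoid.of a)) p l).map
      fun x => R.h (FreeMonoid.of x.2)).prod = R.h (FreeMonoid.ofList l) := by
    intro p l
    induction l generalizing p with
    | nil => exact (map_one R.h).symm
    | cons a l ih =>
      rw [ListFun.prefixes, List.map_cons, List.prod_cons, ih, FreeMonoid.ofList_cons, map_mul]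
  have key : ∀ (p : M) (l : List A), (List.ofFn fun i : Fin l.length =>
      R.out (p * R.h (FreeMonoid.ofList (l.take i)), l.get i,
        R.h (FreeMonoid.ofList (l.drop (i + 1))))).flatten =
      (ListFun.suffixes (fun x => R.h (FreeMonoid.of x.2))
      (ListFun.prefixes (fun a => R.h (FreeMonoid.of a)) p l)).flatMap
        fun x => R.out (x.2.1, x.2.2, x.1) := by
    intro p l
    induction l generalizing p with
    | nil => rfl
    | cons a l ih =>
      rw [ListFun.prefixes, ListFun.suffixes, List.flatMap_cons, ← ih, value]
      simp [List.ofFn_succ, FreeMonoid.ofList_cons, mul_assoc]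
  rw [← key, RationalFunction.eval]
  simp only [one_mul]

theorem theorem3p6 {A B : Type u} [Finite A] [Nonempty A] [Finite B] [Nonempty B]
    {M : Type v} [Monoid M] [Finite M] (hM : AperiodicMonoid M) (R : RationalFunction A B M) :
    -- the alphabets are, up to a bijection, types of the grammar
    (∃ σ : ListType.{u}, Nonempty (A ≃ σ.El)) ∧ (∃ τ : ListType.{u}, Nonempty (B ≃ τ.El)) ∧
    -- and however they are regarded as such, the rational function is a first-order list function
    ∀ (σ τ : ListType.{u}) (eA : A ≃ σ.El) (eB : B ≃ τ.El),
      FOListFunction σ.list τ.list (fun x => (R.eval (x.map eA.symm)).map eB) := by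
  refine ⟨ListType.exists_equiv A, ListType.exists_equiv B, fun σ τ eA eB => ?_⟩
  obtain ⟨μ, ⟨e⟩⟩ := ListType.exists_equiv.{u} M
  have : Finite σ.El := Finite.of_equiv _ eA
  have : Finite μ.El := Finite.of_equiv _ e
  have left := FOListFunction.prefixes_equiv hM e
    (h := fun a : σ.El => R.h (FreeMonoid.of (eA.symm a))) (.of_finite _)
  have right := FOListFunction.suffixes_equiv (σ := μ.prod σ) hM e
    (h := fun x => R.h (FreeMonoid.of (eA.symm x.2)))
    (.comp _ _ _ _ _ (.of_finite fun a => e (R.h (FreeMonoid.of (eA.symm a))))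
      (.projection₂ μ σ))
  have out : FOListFunction (μ.prod (μ.prod σ)) τ.list fun x =>
      (R.out (e.symm x.2.1, eA.symm x.2.2, e.symm x.1)).map eB :=
    -- All three arguments are finite, so `out` is a finite table.
    .of_finite_left μ _ fun _ => .of_finite_left μ _ fun _ => .of_finite _
  refine (FOListFunction.comp _ _ _ _ _ out.flatMap (.comp _ _ _ _ _ right left)).congr
    fun l => ?_
  rw [RationalFunction.eval_eq_flatMap, ListFun.prefixes_map, ListFun.suffixes_map,
    Function.comp_apply, Function.comp_apply, ListFun.suffixes_map, List.map_flatMap,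
    List.flatMap_map, List.flatMap_map, List.flatMap_map]
  simp only [Equiv.symm_apply_apply]
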